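/- Let $\mathbb{F}_q$ be a finite field with $q$ elements, let $d\ge 5$ be an odd integer and let $m$ be a positive divisor of $d$. Let $p\in\mathbb{F}_q[X]$ be monic irreducible of degree $d/m$, let $\alpha\in\mathbb{F}_q^\times$ and $f=\alpha p^m$, and let $h\in\mathbb{F}_q[X]$ be a nonzero polynomial of degree at most $(d-1)/2$ that is not divisible by $p$. Put $\xi=Y^2+h(X)Y-f(X)\in\mathbb{F}_q[X][Y]$, assume that the affine curve $\xi=0$ is smooth (over an algebraic closure of $\mathbb{F}_q$), and put $\mathbf{A}_{\mathcal H}=\mathbb{F}_q[X][Y]/(\xi)$, with $\overline X,\overline Y$ the classes of $X,Y$. Let $\mathfrak p=\langle p(\overline X),\overline Y\rangle\subset\mathbf{A}_{\mathcal H}$, let $L$ be a field extension of $\mathbf{A}_{\mathcal H}/\mathfrak p$ of degree $m$ (so that $[L:\mathbb{F}_q]=d$), let $\gamma:\mathbf{A}_{\mathcal H}\twoheadrightarrow\mathbf{A}_{\mathcal H}/\mathfrak p\hookrightarrow L$ be the canonical map, and equip $\mathbb{F}_q[X]$ with the composition $\mathbb{F}_q[X]\to\mathbf{A}_{\mathcal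 H}\xrightarrow{\gamma}L$. Write $\tau:x\mapsto x^q$ on an algebraic closure $\overline L$ of $L$. For $K\in\{L,\overline L\}$ let $K\{\tau\}$ be the ring, under addition and composition, of the endomorphisms $\sum_{i=0}^n a_i\tau^i$ of $\overline L$ with $a_i\in K$, and let $\tau_L=\tau^{[L:\mathbb{F}_q]}$. For $\mathbf A\in\{\mathbb{F}_q[X],\mathbf{A}_{\mathcal H}\}$, a Drinfeld $\mathbf A$-module over $L$ is an $\mathbb{F}_q$-algebra morphism $\phi:\mathbf A\to L\{\tau\}$, $a\mapsto\phi_a$, such that the coefficient of $\tau^0$ in $\phi_a$ is the image of $a$ in $L$ for every $a$, and some $\phi_a$ has positive $\tau$-degree. It has rank $r$ if $\deg_\tau(\phi_a)=r\log_q\#(\mathbf A/a\mathbf A)$ for all nonzero $a\in\mathbf A$, and $\mathrm{Dr}_r(\mathbf A,L)$ is the set of those of rank $r$. Two elements $\phi,\phi'$ of it are $\overline L$-isomorphic if there is an invertible $\iota\in\overline L\{\tau\}$ with $\iota\phi_a=\phi'_a\iota$ for all $a\in\mathbf A$. The characteristic polynomial of the Frobenius endomorphism of $\phi\in\mathrm{Dr}_2(\mathbb{F}_q[X],L)$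 is the unique polynomial $Y^2+h_\phi(X)Y-f_\phi(X)$ in $\mathbb{F}_q[X][Y]$ that vanishes at $(\phi_X,\tau_L)$ and satisfies $\deg f_\phi=[L:\mathbb{F}_q]$ and $\deg h_\phi\le[L:\mathbb{F}_q]/2$. Then there is a bijection from the set of $\overline L$-isomorphism classes in $\mathrm{Dr}_2(\mathbb{F}_q[X],L)$ that contain a representative whose characteristic polynomial of the Frobenius endomorphism is $\xi$ to the set of $\overline L$-isomorphism classes in $\mathrm{Dr}_1(\mathbf{A}_{\mathcal H},L)$. For every $\phi\in\mathrm{Dr}_2(\mathbb{F}_q[X],L)$ whose characteristic polynomial of the Frobenius endomorphism is $\xi$, it sends the class of $\phi$ to the class of a $\psi\in\mathrm{Dr}_1(\mathbf{A}_{\mathcal H},L)$ with $\psi_{\overline X}=\phi_X$ and $\psi_{\overline Y}=\tau_L$. -/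

import Mathlib

open Polynomial

noncomputable section

namespace DrinfeldCorr

/-! ### Ore polynomials -/

section Ore

variable (Fq : Type*) [Field Fq] [Fintype Fq]
variable (K : Type*) [Field K] [Algebra Fq K]
variable (E : Type*) [Field E] [Algebra Fq E] [Algebra K E] [IsScalarTower Fq K E]

/-- The Frobenius endomorphism `τ : x ↦ x ^ q` of `E`, as an `𝔽_q`-linear endomorphism. -/
def tau : Module.End Fq E := (FiniteField.frobeniusAlgHom Fq E).toLinearMap

variable {K} in
/-- The endomorphism `∑ aᵢ τ^i` of `E`. The finitely supported sequence of the coefficients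
`aᵢ ∈ K` is stored as a polynomial; the product of `K[X]` plays no role. -/
def oreSum (c : K[X]) : Module.End Fq E := c.sum fun i a => a • tau Fq E ^ i

variable {Fq K E}

theorem tau_pow_apply (i : ℕ) (x : E) : (tau Fq E ^ i) x = x ^ (Fintype.card Fq ^ i) := by
  induction i with
  | zero => simp
  | succ i ih =>
    rw [pow_succ', Module.End.mul_apply, ih]
    simp [tau, FiniteField.frobeniusAlgHom_apply, ← pow_mul, pow_succ]

theorem oreSum_apply (c : K[X]) (x : E) :
    oreSum Fq E c x = c.sum fun i a => algebraMap K E a * x ^ (Fintype.card Fq ^ i) := by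
  simp [oreSum, Polynomial.sum, LinearMap.sum_apply, tau_pow_apply, Algebra.smul_def]

theorem oreSum_add (c c' : K[X]) :
    oreSum Fq E (c + c') = oreSum Fq E c + oreSum Fq E c' :=
  Polynomial.sum_add_index c c' _ (by simp) (by simp [add_smul])

theorem oreSum_monomial (i : ℕ) (a : K) :
    oreSum Fq E (monomial i a) = a • tau Fq E ^ i :=
  Polynomial.sum_monomial_index a _ (by simp)

theorem monomial_mul_monomial_tau (i j : ℕ) (a b : K) :
    (a • tau Fq E ^ i) * (b • tau Fq E ^ j)
      = (a * b ^ (Fintype.card Fq ^ i)) • tau Fq E ^ (i + j) := by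
  ext x
  simp only [Module.End.mul_apply, LinearMap.smul_apply, tau_pow_apply, Algebra.smul_def, mul_pow,
    map_mul, map_pow, ← pow_mul, pow_add]
  ring

variable (Fq K E)

/-- The ring `K{τ}` of Ore polynomials: the ring of the `𝔽_q`-linear endomorphisms of `E` of the
form `∑ aᵢ τ^i` with `aᵢ ∈ K`, under addition and composition. It is used with `E` an algebraic
closure of `K`. -/
def OreRing : Subalgebra Fq (Module.End Fq E) where
  carrier := Set.range (oreSum (K := K) Fq E)
  mul_mem' := by
    rintro _ _ ⟨c, rfl⟩ ⟨c', rfl⟩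
    induction c using Polynomial.induction_on' with
    | add c₁ c₂ h₁ h₂ =>
      obtain ⟨e₁, h₁⟩ := h₁
      obtain ⟨e₂, h₂⟩ := h₂
      exact ⟨e₁ + e₂, by rw [oreSum_add, oreSum_add, add_mul, h₁, h₂]⟩
    | monomial i a =>
      induction c' using Polynomial.induction_on' with
      | add c₁ c₂ h₁ h₂ =>
        obtain ⟨e₁, h₁⟩ := h₁
        obtain ⟨e₂, h₂⟩ := h₂
        exact ⟨e₁ + e₂, by rw [oreSum_add, oreSum_add, mul_add, h₁, h₂]⟩
      | monomial j b =>
        exact ⟨monomial (i + j) (a * b ^ (Fintype.card Fq ^ i)), by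
          rw [oreSum_monomial, oreSum_monomial, oreSum_monomial, monomial_mul_monomial_tau]⟩
  add_mem' := by
    rintro _ _ ⟨c, rfl⟩ ⟨c', rfl⟩
    exact ⟨c + c', oreSum_add c c'⟩
  algebraMap_mem' r := ⟨monomial 0 (algebraMap Fq K r), by
    rw [oreSum_monomial, pow_zero, algebraMap_smul, Algebra.algebraMap_eq_smul_one]⟩

variable {Fq K E}

/-- The coefficients of an Ore polynomial; they are unique when `E` is infinite, see
`oreSum_injective`. -/
def coeffs (P : OreRing Fq K E) : K[X] := P.2.choose

/-- The coefficient of `τ^i` in `P`. -/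
def coeff (P : OreRing Fq K E) (i : ℕ) : K := (coeffs P).coeff i

/-- The `τ`-degree of `P` (with the value `0` at `P = 0`). -/
def tauDegree (P : OreRing Fq K E) : ℕ := (coeffs P).natDegree

theorem oreSum_coeffs (P : OreRing Fq K E) : oreSum Fq E (coeffs P) = P := P.2.choose_spec

theorem oreSum_injective [Infinite E] : Function.Injective (oreSum (K := K) Fq E) := by
  intro c c' hcc
  have hq : 1 < Fintype.card Fq := Fintype.one_lt_card
  let lift : K[X] → E[X] := fun c => c.sum fun i a => monomial (Fintype.card Fq ^ i)
    (algebraMap K E a)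
  have hev : ∀ (c : K[X]) (x : E), (lift c).eval x = oreSum Fq E c x := by
    intro c x
    simp [lift, oreSum_apply, Polynomial.sum, eval_finsetSum]
  have hl : lift c = lift c' := Polynomial.funext fun x => by rw [hev, hev, hcc]
  have hco : ∀ (c : K[X]) (n : ℕ),
      (lift c).coeff (Fintype.card Fq ^ n) = algebraMap K E (c.coeff n) := by
    intro c n
    simp only [lift, Polynomial.sum, finsetSum_coeff, coeff_monomial,
      (Nat.pow_right_injective hq).eq_iff]
    rw [Finset.sum_ite_eq' c.support n]
    split_ifs with h
    · rfl
    · rw [notMem_support_iff.mp h, map_zero]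
  ext n
  apply (algebraMap K E).injective
  rw [← hco, ← hco, hl]

theorem coeffs_eq [Infinite E] {P : OreRing Fq K E} {c : K[X]} (h : oreSum Fq E c = P) :
    coeffs P = c :=
  oreSum_injective ((oreSum_coeffs P).trans h.symm)

variable (Fq K E)

/-- `τ` as an element of `K{τ}`. -/
def oreTau : OreRing Fq K E := ⟨tau Fq E, monomial 1 1, by rw [oreSum_monomial, one_smul, pow_one]⟩

end Ore

/-! ### Drinfeld modules -/

section Drinfeld

variable {Fq : Type*} [Field Fq] [Fintype Fq]
variable {A : Type*} [CommRing A] [Algebra Fq A]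
variable {K : Type*} [Field K] [Algebra Fq K]

variable (Fq) in
/-- The degree `log_q #(A / aA) = dim_{𝔽_q} (A / aA)` of a nonzero element `a` of `A`. -/
def elemDegree (a : A) : ℕ := Module.finrank Fq (A ⧸ Ideal.span {a})

/-- A Drinfeld `A`-module over `K`, where `K` is equipped with `γ : A → K`. -/
structure DrinfeldModule (γ : A →ₐ[Fq] K) where
  /-- the morphism `a ↦ φ_a` -/
  hom : A →ₐ[Fq] OreRing Fq K (AlgebraicClosure K)
  coeff_zero : ∀ a, coeff (hom a) 0 = γ a
  exists_tauDegree_pos : ∃ a, 0 < tauDegree (hom a)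

/-- `Dr_r(A, K)`: the Drinfeld `A`-modules of rank `r` over `K`. -/
def Dr (r : ℕ) (γ : A →ₐ[Fq] K) : Type _ :=
  {φ : DrinfeldModule γ // ∀ a : A, a ≠ 0 → tauDegree (φ.hom a) = r * elemDegree Fq a}

/-- The Ore polynomial `φ_a`. -/
def Dr.act {r : ℕ} {γ : A →ₐ[Fq] K} (φ : Dr r γ) : A →ₐ[Fq] OreRing Fq K (AlgebraicClosure K) :=
  φ.1.hom

/-- `φ` and `ψ` are isomorphic over the algebraic closure `K̄` of `K`: there is an invertible
`ι ∈ K̄{τ}` with `ι φ_a = ψ_a ι` for all `a`. -/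
def IsoClosure {r : ℕ} {γ : A →ₐ[Fq] K} (φ ψ : Dr r γ) : Prop :=
  ∃ ι : (OreRing Fq (AlgebraicClosure K) (AlgebraicClosure K))ˣ, ∀ a : A,
    ((ι : OreRing Fq (AlgebraicClosure K) (AlgebraicClosure K)) :
        Module.End Fq (AlgebraicClosure K)) * (φ.act a : Module.End Fq (AlgebraicClosure K))
      = (ψ.act a : Module.End Fq (AlgebraicClosure K)) *
        ((ι : OreRing Fq (AlgebraicClosure K) (AlgebraicClosure K)) :
          Module.End Fq (AlgebraicClosure K))

/-- `K̄`-isomorphism as an equivalence relation on `Dr_r(A, K)`. -/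
def isoSetoid (r : ℕ) (γ : A →ₐ[Fq] K) : Setoid (Dr r γ) where
  r := IsoClosure
  iseqv :=
    { refl := fun φ => ⟨1, fun a => by simp⟩
      symm := by
        rintro φ ψ ⟨u, hu⟩
        refine ⟨u⁻¹, fun a => ?_⟩
        have h1 : ((u⁻¹.1 : OreRing Fq (AlgebraicClosure K) (AlgebraicClosure K)) :
            Module.End Fq (AlgebraicClosure K)) * (u.1 : Module.End Fq (AlgebraicClosure K)) = 1 :=
          congrArg Subtype.val u.inv_mul
        have h2 : (u.1 : Module.End Fq (AlgebraicClosure K)) *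
            ((u⁻¹.1 : OreRing Fq (AlgebraicClosure K) (AlgebraicClosure K)) :
            Module.End Fq (AlgebraicClosure K)) = 1 :=
          congrArg Subtype.val u.mul_inv
        calc _ = (u⁻¹.1 : Module.End Fq (AlgebraicClosure K)) * ((ψ.act a).1 * u.1.1) * u⁻¹.1.1 := by
              rw [mul_assoc, mul_assoc, h2, mul_one]
          _ = _ := by rw [← hu a, ← mul_assoc, h1, one_mul]
      trans := by
        rintro φ ψ χ ⟨u, hu⟩ ⟨v, hv⟩
        refine ⟨v * u, fun a => ?_⟩
        simp only [Units.val_mul, MulMemClass.coe_mul]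
        rw [mul_assoc, hu, ← mul_assoc, hv, mul_assoc] }

/-- The set of `K̄`-isomorphism classes in `Dr_r(A, K)`. -/
abbrev IsoClass (r : ℕ) (γ : A →ₐ[Fq] K) : Type _ := Quotient (isoSetoid r γ)

/-- The class of a Drinfeld module. -/
abbrev isoClass {r : ℕ} {γ : A →ₐ[Fq] K} (φ : Dr r γ) : IsoClass r γ :=
  Quotient.mk (isoSetoid r γ) φ

end Drinfeld

/-! ### The Frobenius endomorphism and its characteristic polynomial -/

section Frobenius

variable {Fq : Type*} [Field Fq] [Fintype Fq]

/-- The polynomial `Y ^ 2 + h(X) Y - f(X)` of `𝔽_q[X][Y]`. -/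
def curvePoly (h f : Fq[X]) : Fq[X][X] := X ^ 2 + C h * X - C f

variable (Fq) in
/-- The Frobenius endomorphism `τ_L = τ ^ [L : 𝔽_q]`. -/
def tauL (L : Type*) [Field L] [Algebra Fq L] : OreRing Fq L (AlgebraicClosure L) :=
  oreTau Fq L (AlgebraicClosure L) ^ Module.finrank Fq L

/-- `ξ ∈ 𝔽_q[X][Y]` is the characteristic polynomial of the Frobenius endomorphism of
`φ ∈ Dr_2(𝔽_q[X], L)`: it has the form `Y ^ 2 + h(X) Y - f(X)` with `deg f = [L : 𝔽_q]`,
`deg h ≤ [L : 𝔽_q] / 2` and `ξ(φ_X, τ_L) = 0`. When `[L : 𝔽_q]` is odd these conditions determine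
`ξ`. -/
def IsFrobeniusCharpoly {L : Type*} [Field L] [Algebra Fq L] {γ : Fq[X] →ₐ[Fq] L}
    (φ : Dr 2 γ) (ξ : Fq[X][X]) : Prop :=
  ξ.eval₂ (φ.act : Fq[X] →+* OreRing Fq L (AlgebraicClosure L)) (tauL Fq L) = 0 ∧
  ∃ h f : Fq[X], ξ = curvePoly h f ∧
    f.degree = Module.finrank Fq L ∧ 2 * h.natDegree ≤ Module.finrank Fq L

end Frobenius

/-! ### The curve `Y ^ 2 + h(X) Y = f(X)` -/

section Curve

variable {Fq : Type*} [Field Fq]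

/-- The affine curve `Y ^ 2 + h(X) Y - f(X) = 0` is smooth: over an algebraic closure, no point of
it is a zero of both partial derivatives. -/
def IsSmoothAffine (h f : Fq[X]) : Prop :=
  ∀ x y : AlgebraicClosure Fq, y ^ 2 + aeval x h * y - aeval x f = 0 →
    ¬ (2 * y + aeval x h = 0 ∧ aeval x (derivative h) * y - aeval x (derivative f) = 0)

/-- The ring `A_H = 𝔽_q[X][Y] / (Y ^ 2 + h(X) Y - f(X))`. -/
abbrev CurveRing (h f : Fq[X]) : Type _ := AdjoinRoot (curvePoly h f)

/-- The inclusion `𝔽_q[X] → A_H`. -/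
def polyIncl (h f : Fq[X]) : Fq[X] →ₐ[Fq] CurveRing h f :=
  IsScalarTower.toAlgHom Fq Fq[X] (CurveRing h f)

/-- The ideal `⟨p(X), Y⟩` of `A_H`. -/
def primeIdeal (h f p : Fq[X]) : Ideal (CurveRing h f) :=
  Ideal.span {polyIncl h f p, AdjoinRoot.root (curvePoly h f)}

/-- The map `γ : A_H → A_H / ⟨p(X), Y⟩ → L`. -/
def gammaH (h f p : Fq[X]) (L : Type*) [Field L] [Algebra Fq L]
    [Algebra (CurveRing h f ⧸ primeIdeal h f p) L]
    [IsScalarTower Fq (CurveRing h f ⧸ primeIdeal h f p) L] : CurveRing h f →ₐ[Fq] L :=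
  (IsScalarTower.toAlgHom Fq (CurveRing h f ⧸ primeIdeal h f p) L).comp
    (Ideal.Quotient.mkₐ Fq (primeIdeal h f p))

/-- The restriction of `γ` to `𝔽_q[X]`. -/
def gammaX (h f p : Fq[X]) (L : Type*) [Field L] [Algebra Fq L]
    [Algebra (CurveRing h f ⧸ primeIdeal h f p) L]
    [IsScalarTower Fq (CurveRing h f ⧸ primeIdeal h f p) L] : Fq[X] →ₐ[Fq] L :=
  (gammaH h f p L).comp (polyIncl h f)

end Curve

end DrinfeldCorr

end

noncomputable section

namespace DrinfeldCorr

section Ore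

variable {Fq : Type*} [Field Fq] [Fintype Fq]
variable {K : Type*} [Field K] [Algebra Fq K]
variable {E : Type*} [Field E] [Algebra Fq E] [Algebra K E] [IsScalarTower Fq K E]

/-- The `n`-th iterate of the `q`-power Frobenius endomorphism, as a ring homomorphism. -/
def frobPow (Fq K : Type*) [Field Fq] [Fintype Fq] [Field K] [Algebra Fq K] (n : ℕ) : K →+* K :=
  (FiniteField.frobeniusAlgHom Fq K ^ n : K →ₐ[Fq] K)

@[simp]
theorem frobPow_apply (n : ℕ) (x : K) : frobPow Fq K n x = x ^ Fintype.card Fq ^ n := by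
  change (FiniteField.frobeniusAlgHom Fq K ^ n) x = _
  rw [AlgHom.coe_pow, FiniteField.coe_frobeniusAlgHom, pow_iterate]

/-- The product of Ore polynomials, on sequences of coefficients. -/
def twistMul (Fq : Type*) [Field Fq] [Fintype Fq] [Algebra Fq K] (c c' : K[X]) : K[X] :=
  c.sum fun i a => monomial i a * c'.map (frobPow Fq K i)

theorem oreSum_mul (c c' : K[X]) :
    oreSum Fq E c * oreSum Fq E c' = oreSum Fq E (twistMul Fq c c') := by
  induction c using Polynomial.induction_on' with
  | add c₁ c₂ h₁ h₂ =>
    rw [oreSum_add, add_mul, h₁, h₂, ← oreSum_add]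
    congr 1
    exact (Polynomial.sum_add_index c₁ c₂ _ (by simp) (by simp [add_mul])).symm
  | monomial i a =>
    have : twistMul Fq (monomial i a) c' = monomial i a * c'.map (frobPow Fq K i) :=
      Polynomial.sum_monomial_index a _ (by simp)
    rw [this]
    induction c' using Polynomial.induction_on' with
    | add c₁ c₂ h₁ h₂ =>
      rw [oreSum_add, mul_add, h₁ _, h₂ _, ← oreSum_add, Polynomial.map_add, mul_add]
      all_goals exact Polynomial.sum_monomial_index a _ (by simp)
    | monomial j b =>
      rw [Polynomial.map_monomial, Polynomial.monomial_mul_monomial, oreSum_monomial,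
        oreSum_monomial, oreSum_monomial, monomial_mul_monomial_tau, frobPow_apply]

theorem coeff_twistMul (c c' : K[X]) (n : ℕ) :
    (twistMul Fq c c').coeff n =
      ∑ i ∈ Finset.range (n + 1), c.coeff i * c'.coeff (n - i) ^ Fintype.card Fq ^ i := by
  have key : ∀ i, (monomial i (c.coeff i) * c'.map (frobPow Fq K i)).coeff n =
      if i < n + 1 then c.coeff i * c'.coeff (n - i) ^ Fintype.card Fq ^ i else 0 := by
    intro i
    rw [← C_mul_X_pow_eq_monomial, mul_assoc, coeff_C_mul, coeff_X_pow_mul', coeff_map,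
      frobPow_apply, mul_ite, mul_zero]
    simp only [Nat.lt_succ_iff]
  rw [twistMul, Polynomial.sum, finsetSum_coeff]
  simp only [key]
  rw [← Finset.sum_filter]
  refine Finset.sum_subset (fun i hi => by simp_all) fun i hi hi' => ?_
  have : c.coeff i = 0 := by simp_all
  rw [this, zero_mul]

variable [Infinite E]

theorem coeff_eq {P : OreRing Fq K E} {c : K[X]} (h : oreSum Fq E c = P) (n : ℕ) :
    coeff P n = c.coeff n := by rw [coeff, coeffs_eq h]

omit [Infinite E] in
theorem coeffs_injective : Function.Injective (coeffs : OreRing Fq K E → K[X]) := fun P Q h =>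
  Subtype.ext (by rw [← oreSum_coeffs, ← oreSum_coeffs, h])

omit [Infinite E] in
theorem ore_ext {P Q : OreRing Fq K E} (h : ∀ n, coeff P n = coeff Q n) : P = Q :=
  coeffs_injective (Polynomial.ext h)

theorem coeffs_add (P Q : OreRing Fq K E) : coeffs (P + Q) = coeffs P + coeffs Q :=
  coeffs_eq (by rw [oreSum_add, oreSum_coeffs, oreSum_coeffs]; rfl)

theorem coeffs_zero : coeffs (0 : OreRing Fq K E) = 0 := coeffs_eq (by simp [oreSum])

theorem coeffs_ne_zero {P : OreRing Fq K E} (h : P ≠ 0) : coeffs P ≠ 0 := fun h' =>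
  h (coeffs_injective (h'.trans coeffs_zero.symm))

theorem coeff_add (P Q : OreRing Fq K E) (n : ℕ) : coeff (P + Q) n = coeff P n + coeff Q n := by
  rw [coeff, coeffs_add, Polynomial.coeff_add]; rfl

theorem coeff_zero' (n : ℕ) : coeff (0 : OreRing Fq K E) n = 0 := by
  rw [coeff, coeffs_zero, Polynomial.coeff_zero]

theorem coeff_mul (P Q : OreRing Fq K E) (n : ℕ) : coeff (P * Q) n =
    ∑ i ∈ Finset.range (n + 1), coeff P i * coeff Q (n - i) ^ Fintype.card Fq ^ i := by
  rw [coeff_eq (c := twistMul Fq (coeffs P) (coeffs Q)), coeff_twistMul]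
  · rfl
  · rw [← oreSum_mul, oreSum_coeffs, oreSum_coeffs]; rfl

theorem coeff_mul_zero (P Q : OreRing Fq K E) : coeff (P * Q) 0 = coeff P 0 * coeff Q 0 := by
  simp [coeff_mul]

theorem coeff_one (n : ℕ) : coeff (1 : OreRing Fq K E) n = if n = 0 then 1 else 0 := by
  rw [coeff_eq (c := 1), Polynomial.coeff_one]
  rw [← C_1, ← monomial_zero_left, oreSum_monomial, one_smul, pow_zero]; rfl

theorem coeff_tau_pow (d n : ℕ) :
    coeff (oreTau Fq K E ^ d) n = if n = d then 1 else 0 := by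
  rw [coeff_eq (c := monomial d 1), coeff_monomial]
  · simp only [eq_comm]
  · rw [oreSum_monomial, one_smul]; rfl

/-- The lowest coefficient of a product. -/
theorem coeff_mul_low {P Q : OreRing Fq K E} {a b : ℕ} (hP : ∀ i < a, coeff P i = 0)
    (hQ : ∀ i < b, coeff Q i = 0) :
    coeff (P * Q) (a + b) = coeff P a * coeff Q b ^ Fintype.card Fq ^ a := by
  rw [coeff_mul, Finset.sum_eq_single a]
  · rw [Nat.add_sub_cancel_left]
  · intro i hi hia
    rcases lt_or_gt_of_ne hia with h | h
    · rw [hP i h, zero_mul]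
    · rw [hQ _ (by rw [Finset.mem_range] at hi; omega), zero_pow (by positivity), mul_zero]
  · simp

/-- The coefficients of a product below the lowest one vanish. -/
theorem coeff_mul_of_lt {P Q : OreRing Fq K E} {a b : ℕ} (hP : ∀ i < a, coeff P i = 0)
    (hQ : ∀ i < b, coeff Q i = 0) (n : ℕ) (hn : n < a + b) : coeff (P * Q) n = 0 := by
  rw [coeff_mul]
  refine Finset.sum_eq_zero fun i hi => ?_
  rcases lt_or_ge i a with h | h
  · rw [hP i h, zero_mul]
  · rw [hQ _ (by rw [Finset.mem_range] at hi; omega), zero_pow (by positivity), mul_zero]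

theorem coeff_pow_of_lt {P : OreRing Fq K E} {a : ℕ} (hP : ∀ i < a, coeff P i = 0) (m : ℕ) :
    ∀ n < m * a, coeff (P ^ m) n = 0 := by
  induction m with
  | zero => simp
  | succ m ih =>
    intro n hn
    rw [pow_succ]
    exact coeff_mul_of_lt ih hP n (by rwa [← Nat.succ_mul])

/-- The coefficient of a product in the sum of two degree bounds. -/
theorem coeff_mul_high {P Q : OreRing Fq K E} {a b : ℕ} (hP : ∀ i, a < i → coeff P i = 0)
    (hQ : ∀ i, b < i → coeff Q i = 0) :
    coeff (P * Q) (a + b) = coeff P a * coeff Q b ^ Fintype.card Fq ^ a := by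
  rw [coeff_mul, Finset.sum_eq_single a]
  · rw [Nat.add_sub_cancel_left]
  · intro i hi hia
    rcases lt_or_gt_of_ne hia with h | h
    · rw [hQ _ (by rw [Finset.mem_range] at hi; omega), zero_pow (by positivity), mul_zero]
    · rw [hP i h, zero_mul]
  · simp

omit [Infinite E] in
theorem coeff_of_tauDegree_lt {P : OreRing Fq K E} {n : ℕ} (h : tauDegree P < n) :
    coeff P n = 0 := coeff_eq_zero_of_natDegree_lt h

theorem coeff_tauDegree_ne_zero {P : OreRing Fq K E} (h : P ≠ 0) : coeff P (tauDegree P) ≠ 0 :=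
  leadingCoeff_ne_zero.mpr (coeffs_ne_zero h)

omit [Infinite E] in
theorem le_tauDegree {P : OreRing Fq K E} {n : ℕ} (h : coeff P n ≠ 0) : n ≤ tauDegree P :=
  le_natDegree_of_ne_zero h

theorem add_le_tauDegree_mul {P Q : OreRing Fq K E} (hP : P ≠ 0) (hQ : Q ≠ 0) :
    tauDegree P + tauDegree Q ≤ tauDegree (P * Q) := by
  apply le_tauDegree
  rw [coeff_mul_high (fun _ => coeff_of_tauDegree_lt) fun _ => coeff_of_tauDegree_lt]
  exact mul_ne_zero (coeff_tauDegree_ne_zero hP) (pow_ne_zero _ (coeff_tauDegree_ne_zero hQ))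

theorem coeff_mul_tau_pow (P : OreRing Fq K E) (d n : ℕ) :
    coeff (P * oreTau Fq K E ^ d) n = if d ≤ n then coeff P (n - d) else 0 := by
  rw [coeff_mul]
  split_ifs with h
  · rw [Finset.sum_eq_single (n - d)]
    · rw [coeff_tau_pow, if_pos (by omega), one_pow, mul_one]
    · intro i hi hne
      rw [Finset.mem_range] at hi
      rw [coeff_tau_pow, if_neg (by omega), zero_pow (by positivity), mul_zero]
    · simp
  · refine Finset.sum_eq_zero fun i hi => ?_
    rw [coeff_tau_pow, if_neg (by omega), zero_pow (by positivity), mul_zero]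

theorem coeff_tau_pow_mul (P : OreRing Fq K E) (d n : ℕ) : coeff (oreTau Fq K E ^ d * P) n =
    if d ≤ n then coeff P (n - d) ^ Fintype.card Fq ^ d else 0 := by
  rw [coeff_mul]
  split_ifs with h
  · rw [Finset.sum_eq_single d]
    · rw [coeff_tau_pow, if_pos rfl, one_mul]
    · intro i hi hne
      rw [coeff_tau_pow, if_neg hne, zero_mul]
    · intro hd; simp at hd; omega
  · refine Finset.sum_eq_zero fun i hi => ?_
    rw [Finset.mem_range] at hi
    rw [coeff_tau_pow, if_neg (by omega), zero_mul]

theorem tauDegree_eq_zero_of_isUnit (u : (OreRing Fq K E)ˣ) : tauDegree u.1 = 0 := by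
  have h1 : (1 : OreRing Fq K E) ≠ 0 := fun h => by
    have := coeff_one (Fq := Fq) (K := K) (E := E) 0
    rw [h, coeff_zero'] at this
    simp at this
  have hu : u.1 ≠ 0 := fun h => h1 (by rw [← u.mul_inv, h, zero_mul])
  have hv : u⁻¹.1 ≠ 0 := fun h => h1 (by rw [← u.mul_inv, h, mul_zero])
  have := add_le_tauDegree_mul hu hv
  have hd : tauDegree (1 : OreRing Fq K E) = 0 := by
    by_contra h0
    have := coeff_tauDegree_ne_zero h1
    rw [coeff_one, if_neg h0] at this
    exact this rfl
  rw [u.mul_inv, hd] at this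
  omega

variable (Fq E) in
/-- A constant, as an Ore polynomial. -/
def oreC (a : K) : OreRing Fq K E := ⟨oreSum Fq E (C a), C a, rfl⟩

omit [Infinite E] in
theorem oreC_apply (a : K) (x : E) : (oreC Fq E a).1 x = algebraMap K E a * x := by
  simp [oreC, oreSum_apply]

omit [Infinite E] in
theorem oreC_mul_inv {a : K} (ha : a ≠ 0) : oreC Fq E a * oreC Fq E a⁻¹ = 1 := by
  apply Subtype.ext
  ext x
  simp [Module.End.mul_apply, oreC_apply, ha]

omit [Infinite E] in
theorem eq_oreC {P : OreRing Fq K E} (h : tauDegree P = 0) : P = oreC Fq E (coeff P 0) := by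
  apply Subtype.ext
  change _ = oreSum Fq E (C _)
  rw [← oreSum_coeffs, coeff, ← eq_C_of_natDegree_eq_zero h]

end Ore

section Iso

variable {Fq : Type*} [Field Fq] [Fintype Fq]
variable {A : Type*} [CommRing A] [Algebra Fq A]
variable {K : Type*} [Field K] [Algebra Fq K]
variable {E : Type*} [Field E] [Algebra Fq E] [Algebra K E] [IsScalarTower Fq K E]

theorem oreSum_map_algebraMap (c : K[X]) :
    oreSum Fq E (c.map (algebraMap K E)) = oreSum Fq E c := by
  induction c using Polynomial.induction_on' with
  | add c₁ c₂ h₁ h₂ => rw [Polynomial.map_add, oreSum_add, oreSum_add, h₁, h₂]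
  | monomial i a => rw [map_monomial, oreSum_monomial, oreSum_monomial, algebraMap_smul]

/-- Conjugation by a constant, in terms of coefficients. -/
theorem oreC_mul_eq_iff [Infinite E] (c : E) (P Q : OreRing Fq K E) :
    (oreC Fq E c).1 * P.1 = Q.1 * (oreC Fq E c).1 ↔
      ∀ i, c * algebraMap K E (coeff P i) =
        algebraMap K E (coeff Q i) * c ^ Fintype.card Fq ^ i := by
  have h1 : (oreC Fq E c).1 * P.1 =
      oreSum Fq E (twistMul Fq (C c) ((coeffs P).map (algebraMap K E))) := by
    rw [← oreSum_mul, oreSum_map_algebraMap, oreSum_coeffs]; rfl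
  have h2 : Q.1 * (oreC Fq E c).1 =
      oreSum Fq E (twistMul Fq ((coeffs Q).map (algebraMap K E)) (C c)) := by
    rw [← oreSum_mul, oreSum_map_algebraMap, oreSum_coeffs]; rfl
  rw [h1, h2, oreSum_injective.eq_iff, Polynomial.ext_iff]
  refine forall_congr' fun n => ?_
  rw [coeff_twistMul, coeff_twistMul, Finset.sum_eq_single 0, Finset.sum_eq_single n]
  · simp [coeff]
  · intro i hi hne
    rw [Finset.mem_range] at hi
    rw [coeff_C_of_ne_zero (n := n - i) (by omega), zero_pow (by positivity), mul_zero]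
  · simp
  · intro i _ hne
    rw [coeff_C_of_ne_zero hne, zero_mul]
  · simp

theorem isoClosure_iff {r : ℕ} {γ : A →ₐ[Fq] K} (φ ψ : Dr r γ) :
    IsoClosure φ ψ ↔ ∃ c : AlgebraicClosure K, c ≠ 0 ∧ ∀ a i,
      c * algebraMap K _ (coeff (φ.act a) i) =
        algebraMap K _ (coeff (ψ.act a) i) * c ^ Fintype.card Fq ^ i := by
  constructor
  · rintro ⟨u, hu⟩
    have huC := eq_oreC (tauDegree_eq_zero_of_isUnit u)
    refine ⟨coeff u.1 0, fun h0 => ?_, fun a => ?_⟩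
    · have := coeff_tauDegree_ne_zero (P := u.1) u.ne_zero
      rw [tauDegree_eq_zero_of_isUnit] at this
      exact this h0
    · rw [← oreC_mul_eq_iff, ← huC]
      exact hu a
  · rintro ⟨c, hc, h⟩
    refine ⟨⟨oreC _ _ c, oreC _ _ c⁻¹, oreC_mul_inv hc, ?_⟩, fun a => ?_⟩
    · have := oreC_mul_inv (Fq := Fq) (E := AlgebraicClosure K) (inv_ne_zero hc)
      rwa [inv_inv] at this
    · exact (oreC_mul_eq_iff _ _ _).mpr (h a)

end Iso

section CurveRingStructure

variable {Fq : Type*} [Field Fq]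

theorem curvePoly_eq (h f : Fq[X]) : curvePoly h f = X ^ 2 + (C h * X + C (-f)) := by
  rw [curvePoly, C_neg]; ring

theorem degree_linear_lt_two (a b : Fq[X]) : (C a * X + C b : Fq[X][X]).degree < 2 :=
  degree_linear_le.trans_lt (by norm_num)

theorem curvePoly_monic (h f : Fq[X]) : (curvePoly h f).Monic := by
  rw [curvePoly_eq]
  exact monic_X_pow_add (degree_linear_lt_two _ _)

theorem curvePoly_natDegree (h f : Fq[X]) : (curvePoly h f).natDegree = 2 := by
  rw [curvePoly_eq]
  apply natDegree_eq_of_degree_eq_some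
  rw [degree_add_eq_left_of_degree_lt, degree_X_pow, Nat.cast_ofNat]
  rw [degree_X_pow]
  exact degree_linear_lt_two _ _

/-- The class of `Y`. -/
abbrev curveY (h f : Fq[X]) : CurveRing h f := AdjoinRoot.root (curvePoly h f)

theorem polyIncl_apply (h f a : Fq[X]) : polyIncl h f a = AdjoinRoot.of (curvePoly h f) a := rfl

theorem curveY_relation (h f : Fq[X]) :
    curveY h f * (curveY h f + polyIncl h f h) = polyIncl h f f := by
  have : AdjoinRoot.mk (curvePoly h f) (X ^ 2 + C h * X - C f) = 0 := AdjoinRoot.mk_self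
  rw [map_sub, map_add, map_mul, map_pow, AdjoinRoot.mk_X, AdjoinRoot.mk_C, AdjoinRoot.mk_C,
    sub_eq_zero] at this
  rw [polyIncl_apply, polyIncl_apply, ← this]
  ring

/-- The basis `1, Y` of the coordinate ring. -/
def curveBasis (h f : Fq[X]) : Module.Basis (Fin 2) Fq[X] (CurveRing h f) :=
  (AdjoinRoot.powerBasis' (curvePoly_monic h f)).basis.reindex
    (finCongr (curvePoly_natDegree h f))

theorem curveBasis_zero (h f : Fq[X]) : curveBasis h f 0 = 1 := by
  simp [curveBasis]
  exact pow_zero _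

theorem curveBasis_one (h f : Fq[X]) : curveBasis h f 1 = curveY h f := by
  simp [curveBasis]
  exact pow_one _

theorem curveRing_exists_eq (h f : Fq[X]) (b : CurveRing h f) :
    ∃ a₀ a₁, b = polyIncl h f a₀ + polyIncl h f a₁ * curveY h f := by
  refine ⟨(curveBasis h f).repr b 0, (curveBasis h f).repr b 1, ?_⟩
  conv_lhs => rw [← (curveBasis h f).sum_repr b]
  rw [Fin.sum_univ_two, curveBasis_zero, curveBasis_one, Algebra.smul_def, Algebra.smul_def,
    mul_one]
  rfl

theorem norm_curveRing (h f a₀ a₁ : Fq[X]) :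
    Algebra.norm Fq[X] (polyIncl h f a₀ + polyIncl h f a₁ * curveY h f) =
      a₀ ^ 2 - h * a₀ * a₁ - f * a₁ ^ 2 := by
  have e0 : (polyIncl h f a₀ + polyIncl h f a₁ * curveY h f) * curveBasis h f 0 =
      a₀ • curveBasis h f 0 + a₁ • curveBasis h f 1 := by
    rw [curveBasis_zero, curveBasis_one, Algebra.smul_def, Algebra.smul_def, mul_one, mul_one]
    rfl
  have e1 : (polyIncl h f a₀ + polyIncl h f a₁ * curveY h f) * curveBasis h f 1 =
      (a₁ * f) • curveBasis h f 0 + (a₀ - a₁ * h) • curveBasis h f 1 := by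
    rw [curveBasis_zero, curveBasis_one, Algebra.smul_def, Algebra.smul_def, mul_one]
    change _ = polyIncl h f (a₁ * f) + polyIncl h f (a₀ - a₁ * h) * curveY h f
    rw [map_mul, map_sub, map_mul, ← curveY_relation]
    ring
  rw [Algebra.norm_eq_matrix_det (curveBasis h f), Matrix.det_fin_two]
  simp only [Algebra.leftMulMatrix_eq_repr_mul, e0, e1]
  simp
  ring

variable {h f : Fq[X]} {d : ℕ}

open scoped Classical in
/-- The degree of the norm of `a₀ + a₁ Y` for `f` of odd degree `d` and `h` of degree
less than `d / 2`. -/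
theorem natDegree_norm_curveRing (hd : Odd d) (hf : f.natDegree = d)
    (hh : 2 * h.natDegree < d) {a₀ a₁ : Fq[X]} (ha : a₀ ≠ 0 ∨ a₁ ≠ 0) :
    a₀ ^ 2 - h * a₀ * a₁ - f * a₁ ^ 2 ≠ 0 ∧
    (a₀ ^ 2 - h * a₀ * a₁ - f * a₁ ^ 2).natDegree =
      max (2 * a₀.natDegree) (if a₁ = 0 then 0 else d + 2 * a₁.natDegree) := by
  have hf0 : f ≠ 0 := by rintro rfl; simp at hf; omega
  by_cases h1 : a₁ = 0
  · subst h1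
    simp_all
  by_cases h0 : a₀ = 0
  · subst h0
    simp [h1, hf0, natDegree_mul, hf]
  have n0 : (a₀ ^ 2).natDegree = 2 * a₀.natDegree := natDegree_pow _ _
  have n1 : (f * a₁ ^ 2).natDegree = d + 2 * a₁.natDegree := by
    rw [natDegree_mul hf0 (pow_ne_zero _ h1), natDegree_pow, hf]
  have n2 : (h * a₀ * a₁).natDegree ≤ h.natDegree + a₀.natDegree + a₁.natDegree :=
    natDegree_mul_le.trans (Nat.add_le_add_right natDegree_mul_le _)
  rw [if_neg h1]
  obtain ⟨k, hk⟩ := hd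
  rcases lt_or_gt_of_ne (show 2 * a₀.natDegree ≠ d + 2 * a₁.natDegree by omega) with hlt | hlt
  · have : (a₀ ^ 2 - h * a₀ * a₁).natDegree < (f * a₁ ^ 2).natDegree :=
      (natDegree_sub_le _ _).trans_lt (max_lt (by omega) (by omega))
    have e := natDegree_sub_eq_right_of_natDegree_lt this
    refine ⟨fun h0 => ?_, by omega⟩
    rw [h0, natDegree_zero] at e
    omega
  · have : (h * a₀ * a₁ + f * a₁ ^ 2).natDegree < (a₀ ^ 2).natDegree :=
      (natDegree_add_le _ _).trans_lt (max_lt (by omega) (by omega))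
    have e := natDegree_sub_eq_left_of_natDegree_lt this
    rw [sub_sub]
    refine ⟨fun h0 => ?_, by omega⟩
    rw [h0, natDegree_zero] at e
    omega

theorem polyIncl_add_eq_zero (h f : Fq[X]) {a₀ a₁ : Fq[X]}
    (hz : polyIncl h f a₀ + polyIncl h f a₁ * curveY h f = 0) : a₀ = 0 ∧ a₁ = 0 := by
  have e0 : a₀ • curveBasis h f 0 + a₁ • curveBasis h f 1 = 0 := by
    rw [curveBasis_zero, curveBasis_one, Algebra.smul_def, Algebra.smul_def, mul_one, ← hz]; rfl
  have e1 := congrArg (curveBasis h f).repr e0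
  exact ⟨by simpa using DFunLike.congr_fun e1 0, by simpa using DFunLike.congr_fun e1 1⟩

theorem curveRing_isDomain (hd : Odd d) (hf : f.natDegree = d) (hh : 2 * h.natDegree < d) :
    IsDomain (CurveRing h f) := by
  have key : ∀ b : CurveRing h f, Algebra.norm Fq[X] b = 0 → b = 0 := by
    intro b hb
    obtain ⟨a₀, a₁, rfl⟩ := curveRing_exists_eq h f b
    by_contra hne
    have ha : a₀ ≠ 0 ∨ a₁ ≠ 0 := by
      by_contra! hz
      rw [hz.1, hz.2] at hne
      simp at hne
    rw [norm_curveRing] at hb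
    exact (natDegree_norm_curveRing hd hf hh ha).1 hb
  have : Nontrivial (CurveRing h f) := ⟨⟨1, 0, fun h1 => one_ne_zero
    (polyIncl_add_eq_zero h f (a₀ := 1) (a₁ := 0) (by simpa using h1)).1⟩⟩
  have : NoZeroDivisors (CurveRing h f) := ⟨fun {a b} hab => by
    have := Module.Free.of_basis (curveBasis h f)
    have := Module.Finite.of_basis (curveBasis h f)
    have hn := congrArg (Algebra.norm Fq[X]) hab
    rw [map_mul, Algebra.norm_zero, mul_eq_zero] at hn
    exact hn.imp (key a) (key b)⟩
  exact NoZeroDivisors.to_isDomain _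

open scoped Classical in
theorem elemDegree_curveRing (hd : Odd d) (hf : f.natDegree = d) (hh : 2 * h.natDegree < d)
    {a₀ a₁ : Fq[X]} (ha : a₀ ≠ 0 ∨ a₁ ≠ 0) :
    elemDegree Fq (polyIncl h f a₀ + polyIncl h f a₁ * curveY h f) =
      max (2 * a₀.natDegree) (if a₁ = 0 then 0 else d + 2 * a₁.natDegree) := by
  have := curveRing_isDomain hd hf hh
  rw [elemDegree, finrank_quotient_span_eq_natDegree_norm (curveBasis h f), norm_curveRing,
    (natDegree_norm_curveRing hd hf hh ha).2]
  intro hz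
  have := polyIncl_add_eq_zero h f hz
  tauto

theorem elemDegree_polyIncl (hd : Odd d) (hf : f.natDegree = d) (hh : 2 * h.natDegree < d)
    {a : Fq[X]} (ha : a ≠ 0) : elemDegree Fq (polyIncl h f a) = 2 * a.natDegree := by
  simpa using elemDegree_curveRing hd hf hh (a₁ := 0) (Or.inl ha)

theorem elemDegree_curveY (hd : Odd d) (hf : f.natDegree = d) (hh : 2 * h.natDegree < d) :
    elemDegree Fq (curveY h f) = d := by
  simpa using elemDegree_curveRing hd hf hh (a₀ := 0) (a₁ := 1) (Or.inr one_ne_zero)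

theorem elemDegree_polynomial (a : Fq[X]) : elemDegree Fq a = a.natDegree :=
  finrank_quotient_span_eq_natDegree

end CurveRingStructure

section Residue

variable {Fq : Type*} [Field Fq] {h f p : Fq[X]} {L : Type*} [Field L] [Algebra Fq L]
  [Algebra (CurveRing h f ⧸ primeIdeal h f p) L]
  [IsScalarTower Fq (CurveRing h f ⧸ primeIdeal h f p) L]

/-- The map `𝔽_q[X] → A_H / ⟨p(X), Y⟩`. -/
def residueMap (h f p : Fq[X]) : Fq[X] →ₐ[Fq] CurveRing h f ⧸ primeIdeal h f p :=
  (Ideal.Quotient.mkₐ Fq (primeIdeal h f p)).comp (polyIncl h f)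

theorem residueMap_surjective : Function.Surjective (residueMap h f p) := by
  intro b
  obtain ⟨b, rfl⟩ := Ideal.Quotient.mk_surjective b
  obtain ⟨a₀, a₁, rfl⟩ := curveRing_exists_eq h f b
  refine ⟨a₀, (Ideal.Quotient.eq.mpr ?_)⟩
  change polyIncl h f a₀ - (polyIncl h f a₀ + _) ∈ _
  rw [sub_add_cancel_left, neg_mem_iff]
  exact Ideal.mul_mem_left _ _ (Ideal.subset_span (by simp))

theorem ker_residueMap [Nontrivial (CurveRing h f ⧸ primeIdeal h f p)] (hp : Irreducible p) :
    RingHom.ker (residueMap h f p) = Ideal.span {p} := by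
  have hmax : (Ideal.span {p}).IsMaximal :=
    PrincipalIdealRing.isMaximal_of_irreducible hp
  refine (hmax.eq_of_le (RingHom.ker_ne_top _) ?_).symm
  rw [Ideal.span_singleton_le_iff_mem, RingHom.mem_ker]
  exact Ideal.Quotient.eq_zero_iff_mem.mpr (Ideal.subset_span (by simp))

omit [Algebra Fq L] [IsScalarTower Fq (CurveRing h f ⧸ primeIdeal h f p) L] in
variable (h f p L) in
include L in
theorem residueRing_nontrivial : Nontrivial (CurveRing h f ⧸ primeIdeal h f p) :=
  (algebraMap (CurveRing h f ⧸ primeIdeal h f p) L).domain_nontrivial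

omit [Algebra Fq L] [IsScalarTower Fq (CurveRing h f ⧸ primeIdeal h f p) L] in
variable (h f p L) in
include L in
theorem primeIdeal_isMaximal (hp : Irreducible p) : (primeIdeal h f p).IsMaximal := by
  have := residueRing_nontrivial h f p L
  have hmax : (Ideal.span {p}).IsMaximal := PrincipalIdealRing.isMaximal_of_irreducible hp
  rw [← ker_residueMap (h := h) (f := f) hp] at hmax
  apply Ideal.Quotient.maximal_of_isField
  exact (RingHom.quotientKerEquivOfSurjective (residueMap_surjective (h := h) (f := f)
    (p := p))).symm.toMulEquiv.isField ((Ideal.Quotient.maximal_ideal_iff_isField_quotient _).mp hmax)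

variable (L) in
theorem gammaX_eq_zero_iff (hp : Irreducible p) (a : Fq[X]) : gammaX h f p L a = 0 ↔ p ∣ a := by
  have := residueRing_nontrivial h f p L
  have := primeIdeal_isMaximal h f p L hp
  let _ := Ideal.Quotient.field (primeIdeal h f p)
  have e : gammaX h f p L a = algebraMap _ L (residueMap h f p a) := rfl
  rw [e, map_eq_zero_iff _ (RingHom.injective _), ← Ideal.mem_span_singleton,
    ← ker_residueMap (h := h) (f := f) hp, RingHom.mem_ker]

theorem gammaH_curveY : gammaH h f p L (curveY h f) = 0 := by
  have : Ideal.Quotient.mk (primeIdeal h f p) (curveY h f) = 0 :=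
    Ideal.Quotient.eq_zero_iff_mem.mpr (Ideal.subset_span (by simp))
  change algebraMap _ L (Ideal.Quotient.mk (primeIdeal h f p) (curveY h f)) = 0
  rw [this, map_zero]

theorem finrank_eq_of_residue (hp : Irreducible p) :
    Module.finrank Fq L =
      p.natDegree * Module.finrank (CurveRing h f ⧸ primeIdeal h f p) L := by
  have := residueRing_nontrivial h f p L
  have := primeIdeal_isMaximal h f p L hp
  let _ := Ideal.Quotient.field (primeIdeal h f p)
  have e := (Ideal.quotientKerAlgEquivOfSurjective
    (residueMap_surjective (h := h) (f := f) (p := p))).toLinearEquiv.finrank_eq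
  rw [← (Ideal.quotientEquivAlgOfEq Fq (ker_residueMap (h := h) (f := f)
    hp).symm).toLinearEquiv.finrank_eq, finrank_quotient_span_eq_natDegree] at e
  rw [e, Module.finrank_mul_finrank]

end Residue

section Ore

variable {Fq : Type*} [Field Fq] [Fintype Fq]
variable {K : Type*} [Field K] [Algebra Fq K]
variable {E : Type*} [Field E] [Algebra Fq E] [Algebra K E] [IsScalarTower Fq K E] [Infinite E]

theorem coeffs_mul_tau_pow (P : OreRing Fq K E) (d : ℕ) :
    coeffs (P * oreTau Fq K E ^ d) = coeffs P * X ^ d := by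
  ext n
  rw [coeff_mul_X_pow']
  exact coeff_mul_tau_pow P d n

theorem tauDegree_zero : tauDegree (0 : OreRing Fq K E) = 0 := by
  rw [tauDegree, coeffs_zero, natDegree_zero]

theorem ne_zero_of_tauDegree_pos {P : OreRing Fq K E} (h : 0 < tauDegree P) : P ≠ 0 := by
  rintro rfl
  rw [tauDegree_zero] at h
  exact h.false

omit [Infinite E] in
theorem tauDegree_congr {P Q : OreRing Fq K E} (h : ∀ i, coeff P i = 0 ↔ coeff Q i = 0) :
    tauDegree P = tauDegree Q :=
  le_antisymm
    (natDegree_le_iff_coeff_eq_zero.mpr fun i hi => (h i).mpr (coeff_of_tauDegree_lt hi))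
    (natDegree_le_iff_coeff_eq_zero.mpr fun i hi => (h i).mp (coeff_of_tauDegree_lt hi))

/-- If the coefficients of `c P c⁻¹` lie in `K`, then `c P c⁻¹` is an element of `K{τ}`. -/
theorem exists_conj {c : E} {P : OreRing Fq K E}
    (h : ∀ i, ∃ b : K, c * algebraMap K E (coeff P i) =
      algebraMap K E b * c ^ Fintype.card Fq ^ i) :
    ∃ Q : OreRing Fq K E, (oreC Fq E c).1 * P.1 = Q.1 * (oreC Fq E c).1 := by
  choose b hb using h
  let P' : K[X] := ∑ i ∈ Finset.range (tauDegree P + 1), monomial i (b i)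
  refine ⟨⟨oreSum Fq E P', P', rfl⟩, (oreC_mul_eq_iff _ _ _).mpr fun i => ?_⟩
  rw [coeff_eq (P := ⟨oreSum Fq E P', P', rfl⟩) (c := P') rfl, finsetSum_coeff]
  simp only [coeff_monomial, Finset.sum_ite_eq', Finset.mem_range]
  split_ifs with hi
  · exact hb i
  · rw [coeff_of_tauDegree_lt (by omega)]
    simp

/-- Conjugation of a morphism to `K{τ}` by a constant. -/
theorem exists_conj_hom {A : Type*} [CommRing A] [Algebra Fq A] {c : E} (hc : c ≠ 0)
    (φ : A →ₐ[Fq] OreRing Fq K E)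
    (h : ∀ a i, ∃ b : K, c * algebraMap K E (coeff (φ a) i) =
      algebraMap K E b * c ^ Fintype.card Fq ^ i) :
    ∃ ψ : A →ₐ[Fq] OreRing Fq K E, ∀ a i, c * algebraMap K E (coeff (φ a) i) =
      algebraMap K E (coeff (ψ a) i) * c ^ Fintype.card Fq ^ i := by
  let e : E ≃ₗ[Fq] E := (LinearEquiv.smulOfNeZero E E c hc).restrictScalars Fq
  have he : (e : Module.End Fq E) = (oreC Fq E c).1 := by
    ext x
    simp [e, oreC_apply]
  have hconj : ∀ T : Module.End Fq E,
      e.conjAlgEquiv Fq T * (oreC Fq E c).1 = (oreC Fq E c).1 * T := by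
    intro T
    rw [← he]
    ext x
    simp [LinearEquiv.conjAlgEquiv, Module.End.mul_apply]
  let g : A →ₐ[Fq] Module.End Fq E :=
    (e.conjAlgEquiv Fq : Module.End Fq E →ₐ[Fq] Module.End Fq E).comp ((OreRing Fq K E).val.comp φ)
  have hg : ∀ a, g a * (oreC Fq E c).1 = (oreC Fq E c).1 * (φ a).1 := fun a => hconj _
  have hinv : (oreC Fq E c).1 * (oreC Fq E c⁻¹).1 = 1 := congrArg Subtype.val (oreC_mul_inv hc)
  refine ⟨g.codRestrict _ fun a => ?_, fun a => ?_⟩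
  · obtain ⟨Q, hQ⟩ := exists_conj (h a)
    have : g a = Q.1 := by
      rw [← mul_one (g a), ← hinv, ← mul_assoc, hg, hQ, mul_assoc, hinv, mul_one]
    rw [this]
    exact Q.2
  · rw [← oreC_mul_eq_iff]
    exact (hg a).symm

end Ore

section Finite

variable {Fq : Type*} [Field Fq] [Fintype Fq]
variable {L : Type*} [Field L] [Algebra Fq L] {d : ℕ}

theorem pow_card_pow_finrank (hd : 0 < d) (hL : Module.finrank Fq L = d) (x : L) :
    x ^ Fintype.card Fq ^ d = x := by
  have : FiniteDimensional Fq L := Module.finite_of_finrank_pos (hL ▸ hd)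
  have : Finite L := Module.finite_of_finite Fq
  have := Fintype.ofFinite L
  rw [← hL, ← Module.card_eq_pow_finrank, FiniteField.pow_card]

theorem exists_algebraMap_eq_of_pow_eq (hd : 0 < d) (hL : Module.finrank Fq L = d)
    {E : Type*} [Field E] [Algebra L E] {x : E} (hx : x ^ Fintype.card Fq ^ d = x) :
    ∃ b : L, algebraMap L E b = x := by
  classical
  have : FiniteDimensional Fq L := Module.finite_of_finrank_pos (hL ▸ hd)
  have : Finite L := Module.finite_of_finite Fq
  have := Fintype.ofFinite L
  rw [← hL, ← Module.card_eq_pow_finrank] at hx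
  have h1 : 1 < Fintype.card L := Fintype.one_lt_card
  have h0 := FiniteField.X_pow_card_sub_X_ne_zero E h1
  have hsub : Finset.univ.image (algebraMap L E) ⊆
      (X ^ Fintype.card L - X : E[X]).roots.toFinset := by
    intro y hy
    obtain ⟨b, -, rfl⟩ := Finset.mem_image.mp hy
    rw [Multiset.mem_toFinset, mem_roots h0]
    simp [← map_pow, FiniteField.pow_card]
  have hcard : (X ^ Fintype.card L - X : E[X]).roots.toFinset.card ≤
      (Finset.univ.image (algebraMap L E)).card := by
    rw [Finset.card_image_of_injective _ (algebraMap L E).injective, Finset.card_univ]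
    refine (Multiset.toFinset_card_le _).trans ((card_roots' _).trans ?_)
    rw [FiniteField.X_pow_card_sub_X_natDegree_eq E h1]
  have hmem : x ∈ (X ^ Fintype.card L - X : E[X]).roots.toFinset := by
    rw [Multiset.mem_toFinset, mem_roots h0]
    simp [hx]
  rw [← Finset.eq_of_subset_of_card_le hsub hcard] at hmem
  simpa using hmem

theorem tauL_eq (hL : Module.finrank Fq L = d) :
    tauL Fq L = oreTau Fq L (AlgebraicClosure L) ^ d := by rw [tauL, hL]

theorem commute_tauL (hd : 0 < d) (hL : Module.finrank Fq L = d)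
    (P : OreRing Fq L (AlgebraicClosure L)) : Commute P (tauL Fq L) :=
  ore_ext fun n => by
    rw [tauL_eq hL, coeff_mul_tau_pow, coeff_tau_pow_mul, pow_card_pow_finrank hd hL]

end Finite

section Extend

variable {Fq : Type*} [Field Fq]

theorem eval₂_curvePoly_add {S : Type*} [Semiring S] (g : Fq[X] →+* S) (y : S) (h f : Fq[X]) :
    (curvePoly h f).eval₂ g y + g f = y * y + g h * y := by
  have : curvePoly h f + C f = X * X + C h * X := by rw [curvePoly]; ring
  rw [← eval₂_C g y, ← eval₂_add, this, eval₂_add, eval₂_mul_X, eval₂_mul_X, eval₂_X, eval₂_C]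

/-- The extension of a morphism from `𝔽_q[X]` to the coordinate ring. -/
theorem exists_lift_curveRing {S : Type*} [Ring S] [Algebra Fq S] {h f : Fq[X]}
    (g : Fq[X] →ₐ[Fq] S) (y : S) (hy : ∀ a, Commute (g a) y)
    (h0 : (curvePoly h f).eval₂ (g : Fq[X] →+* S) y = 0) :
    ∃ G : CurveRing h f →ₐ[Fq] S, (∀ a, G (polyIncl h f a) = g a) ∧ G (curveY h f) = y := by
  let e : Fq[X][X] →+* S := eval₂RingHom' (g : Fq[X] →+* S) y hy
  have he : ∀ a ∈ Ideal.span {curvePoly h f}, e a = 0 := by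
    intro a ha
    obtain ⟨b, rfl⟩ := Ideal.mem_span_singleton.mp ha
    have : e (curvePoly h f) = 0 := h0
    rw [map_mul, this, zero_mul]
  let G : CurveRing h f →+* S := Ideal.Quotient.lift _ e he
  have hG : ∀ a, G (polyIncl h f a) = g a := fun a => eval₂_C (g : Fq[X] →+* S) y
  refine ⟨{ G with commutes' := fun r => ?_ }, hG, eval₂_X (g : Fq[X] →+* S) y⟩
  have := hG (C r)
  rw [← algebraMap_eq, AlgHom.commutes, AlgHom.commutes] at this
  exact this

end Extend

section Correspondence

variable {Fq : Type*} [Field Fq] [Fintype Fq] {h f p : Fq[X]} {d : ℕ}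
  {L : Type*} [Field L] [Algebra Fq L]
  [Algebra (CurveRing h f ⧸ primeIdeal h f p) L]
  [IsScalarTower Fq (CurveRing h f ⧸ primeIdeal h f p) L]

/-- The Drinfeld module `ψ` over the coordinate ring extends `φ`, with `Y` acting as `τ_L`. -/
def Extends (φ : Dr 2 (gammaX h f p L)) (ψ : Dr 1 (gammaH h f p L)) : Prop :=
  (∀ a, ψ.act (polyIncl h f a) = φ.act a) ∧ ψ.act (curveY h f) = tauL Fq L

theorem Dr.coeff_act_zero {A : Type*} [CommRing A] [Algebra Fq A] {r : ℕ} {γ : A →ₐ[Fq] L}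
    (φ : Dr r γ) (a : A) : coeff (φ.act a) 0 = γ a := φ.1.coeff_zero a

theorem tauDegree_act_polynomial (φ : Dr 2 (gammaX h f p L)) {a : Fq[X]} (ha : a ≠ 0) :
    tauDegree (φ.act a) = 2 * a.natDegree := by
  rw [← elemDegree_polynomial]
  exact φ.2 a ha

theorem act_polynomial_ne_zero (φ : Dr 2 (gammaX h f p L)) {a : Fq[X]} (ha : a ≠ 0) :
    φ.act a ≠ 0 := by
  intro h0
  have := tauDegree_act_polynomial φ (mul_ne_zero X_ne_zero ha)
  rw [map_mul, h0, mul_zero, tauDegree_zero, natDegree_X_mul ha] at this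
  omega

theorem exists_extends (hd : Odd d) (hf : f.natDegree = d) (hh : 2 * h.natDegree < d)
    (hL : Module.finrank Fq L = d) (φ : Dr 2 (gammaX h f p L))
    (hφ : IsFrobeniusCharpoly φ (curvePoly h f)) :
    ∃ ψ : Dr 1 (gammaH h f p L), Extends φ ψ := by
  classical
  have hd0 : 0 < d := hd.pos
  obtain ⟨G, hG, hY⟩ := exists_lift_curveRing φ.act (tauL Fq L)
    (fun a => commute_tauL hd0 hL _) hφ.1
  refine ⟨⟨⟨G, fun b => ?_, ?_⟩, fun b hb => ?_⟩, hG, hY⟩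
  · obtain ⟨a₀, a₁, rfl⟩ := curveRing_exists_eq h f b
    rw [map_add, map_mul, hG, hG, hY, coeff_add, coeff_mul_zero, tauL_eq hL, coeff_tau_pow,
      if_neg hd0.ne, mul_zero, map_add, map_mul, gammaH_curveY, mul_zero, φ.coeff_act_zero]
    rfl
  · obtain ⟨a, ha⟩ := φ.1.exists_tauDegree_pos
    exact ⟨polyIncl h f a, by rw [hG]; exact ha⟩
  · obtain ⟨a₀, a₁, rfl⟩ := curveRing_exists_eq h f b
    have ha : a₀ ≠ 0 ∨ a₁ ≠ 0 := by
      by_contra! hz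
      rw [hz.1, hz.2] at hb
      simp at hb
    change tauDegree (G _) = _
    rw [elemDegree_curveRing hd hf hh ha, map_add, map_mul, hG, hG, hY, tauL_eq hL, tauDegree,
      coeffs_add, coeffs_mul_tau_pow, one_mul]
    by_cases h1 : a₁ = 0
    · have h0 : a₀ ≠ 0 := by tauto
      rw [h1, map_zero, coeffs_zero, zero_mul, add_zero, if_pos rfl, max_eq_left (Nat.zero_le _)]
      exact tauDegree_act_polynomial φ h0
    have n1 : (coeffs (φ.act a₁) * X ^ d).natDegree = d + 2 * a₁.natDegree := by
      rw [natDegree_mul_X_pow _ (coeffs_ne_zero (act_polynomial_ne_zero φ h1)), add_comm,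
        ← tauDegree_act_polynomial φ h1]
      rfl
    by_cases h0 : a₀ = 0
    · rw [h0, map_zero, coeffs_zero, zero_add, n1, if_neg h1]
      simp
    have n0 : (coeffs (φ.act a₀)).natDegree = 2 * a₀.natDegree := tauDegree_act_polynomial φ h0
    obtain ⟨k, hk⟩ := hd
    rw [if_neg h1]
    rcases lt_or_gt_of_ne (show 2 * a₀.natDegree ≠ d + 2 * a₁.natDegree by omega) with hlt | hlt
    · rw [natDegree_add_eq_right_of_natDegree_lt (by omega)]; omega
    · rw [natDegree_add_eq_left_of_natDegree_lt (by omega)]; omega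

/-- The Frobenius relation identifies a coefficient of `φ_h` with one of `φ_f`. -/
theorem coeff_act_eq (hd : Odd d) (hL : Module.finrank Fq L = d)
    (φ : Dr 2 (gammaX h f p L)) (hφ : IsFrobeniusCharpoly φ (curvePoly h f)) :
    coeff (φ.act f) (2 * h.natDegree + d) = coeff (φ.act h) (2 * h.natDegree) := by
  have e := eval₂_curvePoly_add (φ.act : Fq[X] →+* OreRing Fq L (AlgebraicClosure L))
    (tauL Fq L) h f
  rw [hφ.1, zero_add] at e
  change φ.act f = _ + φ.act h * _ at e
  obtain ⟨k, hk⟩ := hd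
  rw [e, tauL_eq hL, ← pow_add, coeff_add, coeff_mul_tau_pow, coeff_tau_pow, if_neg (by omega),
    if_pos (by omega), zero_add, Nat.add_sub_cancel]

theorem Extends.isoClosure_iff (hd : Odd d) (hh0 : h ≠ 0) (hL : Module.finrank Fq L = d)
    {φ φ' : Dr 2 (gammaX h f p L)} {ψ ψ' : Dr 1 (gammaH h f p L)}
    (hφ : IsFrobeniusCharpoly φ (curvePoly h f)) (hφ' : IsFrobeniusCharpoly φ' (curvePoly h f))
    (hψ : Extends φ ψ) (hψ' : Extends φ' ψ') : IsoClosure φ φ' ↔ IsoClosure ψ ψ' := by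
  rw [DrinfeldCorr.isoClosure_iff, DrinfeldCorr.isoClosure_iff]
  constructor
  · rintro ⟨c, hc, hcφ⟩
    refine ⟨c, hc, ?_⟩
    have hfix : c ^ Fintype.card Fq ^ d = c := by
      have e1 := hcφ h (2 * h.natDegree)
      have e2 := hcφ f (2 * h.natDegree + d)
      rw [coeff_act_eq hd hL φ hφ, coeff_act_eq hd hL φ' hφ', e1] at e2
      have hne : coeff (φ'.act h) (2 * h.natDegree) ≠ 0 := by
        rw [← tauDegree_act_polynomial φ' hh0]
        exact coeff_tauDegree_ne_zero (act_polynomial_ne_zero φ' hh0)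
      have e3 := mul_left_cancel₀ ((map_ne_zero (algebraMap L (AlgebraicClosure L))).mpr hne) e2
      refine ((frobPow Fq _ (2 * h.natDegree)).injective ?_).symm
      rwa [frobPow_apply, frobPow_apply, ← pow_mul, ← pow_add, add_comm d]
    intro b i
    obtain ⟨a₀, a₁, rfl⟩ := curveRing_exists_eq h f b
    rw [map_add, map_mul, map_add, map_mul, hψ.1, hψ.1, hψ.2, hψ'.1, hψ'.1, hψ'.2, tauL_eq hL,
      coeff_add, coeff_add, coeff_mul_tau_pow, coeff_mul_tau_pow, map_add, map_add, mul_add,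
      add_mul, hcφ]
    congr 1
    split_ifs with hi
    · rw [hcφ]
      congr 1
      conv_rhs => rw [← Nat.add_sub_cancel' hi, pow_add, pow_mul, hfix]
    · simp
  · rintro ⟨c, hc, hcψ⟩
    refine ⟨c, hc, fun a i => ?_⟩
    rw [← hψ.1, ← hψ'.1]
    exact hcψ _ i

theorem coeff_act_prime (hp : Irreducible p) (ψ : Dr 1 (gammaH h f p L)) :
    ∀ i < p.natDegree, coeff (ψ.act (polyIncl h f p)) i = 0 := by
  intro i
  induction i using Nat.strong_induction_on with
  | _ i ih =>
    intro hi
    by_contra hne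
    have h0 : ∀ j < i, coeff (ψ.act (polyIncl h f p)) j = 0 := fun j hj => ih j hj (hj.trans hi)
    have e : coeff (ψ.act (polyIncl h f p) * ψ.act (polyIncl h f X)) (i + 0) =
        coeff (ψ.act (polyIncl h f X) * ψ.act (polyIncl h f p)) (0 + i) := by
      rw [← map_mul, ← map_mul, ← map_mul, ← map_mul, mul_comm, add_comm]
    rw [coeff_mul_low h0 (by simp), coeff_mul_low (by simp) h0, pow_zero, pow_one, mul_comm] at e
    have e := mul_right_cancel₀ hne e
    rw [ψ.coeff_act_zero] at e
    have hdvd : p ∣ X ^ Nat.card Fq ^ i - X := by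
      rw [← gammaX_eq_zero_iff (h := h) (f := f) L hp, map_sub, map_pow, Nat.card_eq_fintype_card,
        sub_eq_zero]
      exact e
    have := hp.natDegree_dvd_of_dvd_X_pow_card_pow_sub_X hdvd
    rcases Nat.eq_zero_or_pos i with rfl | hpos
    · apply hne
      rw [ψ.coeff_act_zero]
      exact (gammaX_eq_zero_iff L hp p).mpr dvd_rfl
    · exact absurd (Nat.le_of_dvd hpos this) (by omega)

/-- `ψ_Y` is a monomial. -/
theorem coeff_act_curveY (hd : Odd d) (hf : f.natDegree = d) (hh : 2 * h.natDegree < d)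
    (hp : Irreducible p) {α : Fq} {m : ℕ} (hfp : f = C α * p ^ m)
    (hdm : m * p.natDegree = d) (hph : ¬ p ∣ h) (ψ : Dr 1 (gammaH h f p L)) :
    coeff (ψ.act (curveY h f)) d ≠ 0 ∧ ∀ i ≠ d, coeff (ψ.act (curveY h f)) i = 0 := by
  have hdom := curveRing_isDomain hd hf hh
  have hY0 : curveY h f ≠ 0 := fun h0 => one_ne_zero
    (polyIncl_add_eq_zero h f (a₀ := 0) (a₁ := 1) (by simpa using h0)).2
  have hdeg : tauDegree (ψ.act (curveY h f)) = d := by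
    rw [← elemDegree_curveY hd hf hh, ← one_mul (elemDegree Fq _)]
    exact ψ.2 _ hY0
  have hne : ψ.act (curveY h f) ≠ 0 := ne_zero_of_tauDegree_pos (hdeg ▸ hd.pos)
  refine ⟨by simpa [hdeg] using coeff_tauDegree_ne_zero hne, fun i hi => ?_⟩
  rcases lt_or_gt_of_ne hi with hlt | hgt
  swap
  · exact coeff_of_tauDegree_lt (by omega)
  have hlow : ∀ j < d, coeff (ψ.act (polyIncl h f f)) j = 0 := by
    intro j hj
    have e : polyIncl h f f = polyIncl h f (C α) * polyIncl h f p ^ m := by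
      rw [← map_pow, ← map_mul, ← hfp]
    rw [e, map_mul, map_pow]
    refine coeff_mul_of_lt (a := 0) (by simp) (coeff_pow_of_lt (coeff_act_prime hp ψ) m) j ?_
    omega
  induction i using Nat.strong_induction_on with
  | _ i ih =>
    have e := hlow (i + 0) hlt
    rw [← curveY_relation, map_mul,
      coeff_mul_low (fun j hj => ih j hj (by omega) (by omega)) (by simp), mul_eq_zero] at e
    refine e.resolve_right (pow_ne_zero _ ?_)
    rw [ψ.coeff_act_zero, map_add, gammaH_curveY, zero_add]
    exact fun h0 => hph ((gammaX_eq_zero_iff L hp h).mp h0)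

/-- Every Drinfeld module of rank one over the coordinate ring has a twist on which `Y` acts as
the Frobenius endomorphism. -/
theorem exists_twist (hd : Odd d) (hf : f.natDegree = d) (hh : 2 * h.natDegree < d)
    (hL : Module.finrank Fq L = d)
    (hp : Irreducible p) {α : Fq} {m : ℕ} (hfp : f = C α * p ^ m)
    (hdm : m * p.natDegree = d) (hph : ¬ p ∣ h) (ψ : Dr 1 (gammaH h f p L)) :
    ∃ ψ' : Dr 1 (gammaH h f p L), IsoClosure ψ ψ' ∧ ψ'.act (curveY h f) = tauL Fq L := by
  obtain ⟨hu, hY⟩ := coeff_act_curveY hd hf hh hp hfp hdm hph ψ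
  have hYlow : ∀ j < d, coeff (ψ.act (curveY h f)) j = 0 := fun j hj => hY j hj.ne
  set u := coeff (ψ.act (curveY h f)) d with hudef
  have huE : algebraMap L (AlgebraicClosure L) u ≠ 0 := (_root_.map_ne_zero _).mpr hu
  have hq : 1 < Fintype.card Fq ^ d := Nat.one_lt_pow hd.pos.ne' Fintype.one_lt_card
  obtain ⟨c, hcu⟩ := IsAlgClosed.exists_pow_nat_eq (algebraMap L (AlgebraicClosure L) u)
    (n := Fintype.card Fq ^ d - 1) (by omega)
  have hc : c ≠ 0 := by
    rintro rfl
    rw [zero_pow (by omega)] at hcu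
    exact huE hcu.symm
  have hcd : c ^ Fintype.card Fq ^ d = c * algebraMap L _ u := by
    rw [← hcu, ← pow_succ', Nat.sub_add_cancel hq.le]
  have hcomm : ∀ b i, coeff (ψ.act b) i * u ^ Fintype.card Fq ^ i = u * coeff (ψ.act b) i := by
    intro b i
    have hhigh : ∀ j, d < j → coeff (ψ.act (curveY h f)) j = 0 := fun j hj => hY j hj.ne'
    have e : coeff (ψ.act b * ψ.act (curveY h f)) (i + d) =
        coeff (ψ.act (curveY h f) * ψ.act b) (i + d) := by rw [← map_mul, ← map_mul, mul_comm]
    rw [coeff_mul, coeff_mul, Finset.sum_eq_single i, Finset.sum_eq_single d] at e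
    · rwa [Nat.add_sub_cancel_left, Nat.add_sub_cancel, pow_card_pow_finrank hd.pos hL] at e
    · intro j _ hj
      rw [hY j hj, zero_mul]
    · simp
    · intro j hj hji
      rw [Finset.mem_range] at hj
      rw [hY _ (by omega), zero_pow (by positivity), mul_zero]
    · simp
  obtain ⟨G, hG⟩ := exists_conj_hom hc ψ.act fun b i => by
    have hci := pow_ne_zero (Fintype.card Fq ^ i) hc
    obtain ⟨a, ha⟩ := exists_algebraMap_eq_of_pow_eq hd.pos hL
      (x := c * algebraMap L _ (coeff (ψ.act b) i) / c ^ Fintype.card Fq ^ i) (by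
        rw [div_pow, mul_pow, ← pow_mul, mul_comm (Fintype.card Fq ^ i), pow_mul, hcd, mul_pow,
          ← map_pow, pow_card_pow_finrank hd.pos hL, div_eq_div_iff
            (mul_ne_zero hci (pow_ne_zero _ huE)) hci]
        have := congrArg (algebraMap L (AlgebraicClosure L)) (hcomm b i)
        rw [map_mul, map_mul, map_pow] at this
        linear_combination -c * c ^ Fintype.card Fq ^ i * this)
    exact ⟨a, by rw [ha, div_mul_cancel₀ _ hci]⟩
  have hdeg : ∀ b, tauDegree (G b) = tauDegree (ψ.act b) := by
    intro b
    refine tauDegree_congr fun i => ?_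
    have := hG b i
    have hci := pow_ne_zero (Fintype.card Fq ^ i) hc
    rw [← map_eq_zero (algebraMap L (AlgebraicClosure L)),
      ← map_eq_zero (algebraMap L (AlgebraicClosure L)), ← mul_eq_zero_iff_right hci, ← this,
      mul_eq_zero_iff_left hc]
  refine ⟨⟨⟨G, fun b => ?_, ?_⟩, fun b hb => (hdeg b).trans (ψ.2 b hb)⟩, ?_, ?_⟩
  · have := hG b 0
    rw [pow_zero, pow_one, mul_comm] at this
    rw [← ψ.coeff_act_zero]
    exact ((algebraMap L (AlgebraicClosure L)).injective (mul_right_cancel₀ hc this)).symm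
  · obtain ⟨b, hb⟩ := ψ.1.exists_tauDegree_pos
    exact ⟨b, (hdeg b).symm ▸ hb⟩
  · exact (isoClosure_iff _ _).mpr ⟨c, hc, hG⟩
  · refine ore_ext fun i => ?_
    change coeff (G _) i = _
    rw [tauL_eq hL, coeff_tau_pow]
    have e := hG (curveY h f) i
    have hci := pow_ne_zero (Fintype.card Fq ^ i) hc
    apply (algebraMap L (AlgebraicClosure L)).injective
    apply mul_right_cancel₀ hci
    rw [← e]
    split_ifs with hi
    · rw [hi, ← hudef, hcd, map_one, one_mul]
    · rw [hY i hi, map_zero, mul_zero, zero_mul]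

/-- A Drinfeld module of rank one on which `Y` acts as the Frobenius endomorphism extends a
Drinfeld module of rank two over `𝔽_q[X]` with the expected characteristic polynomial. -/
theorem exists_restriction (hd : Odd d) (hf : f.natDegree = d) (hh : 2 * h.natDegree < d)
    (hL : Module.finrank Fq L = d) (ψ : Dr 1 (gammaH h f p L))
    (hψ : ψ.act (curveY h f) = tauL Fq L) :
    ∃ φ : Dr 2 (gammaX h f p L), IsFrobeniusCharpoly φ (curvePoly h f) ∧ Extends φ ψ := by
  have hdeg : ∀ a : Fq[X], a ≠ 0 →
      tauDegree (ψ.act (polyIncl h f a)) = 2 * elemDegree Fq a := by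
    intro a ha
    rw [elemDegree_polynomial, ← elemDegree_polyIncl hd hf hh ha, ← one_mul (elemDegree Fq _)]
    refine ψ.2 _ fun h0 => ha ?_
    exact (polyIncl_add_eq_zero h f (a₀ := a) (a₁ := 0) (by simpa using h0)).1
  let φ : Dr 2 (gammaX h f p L) :=
    ⟨⟨ψ.act.comp (polyIncl h f), fun a => ψ.coeff_act_zero _, X, by
      rw [AlgHom.comp_apply, hdeg X X_ne_zero, elemDegree_polynomial, natDegree_X]
      norm_num⟩, hdeg⟩
  refine ⟨φ, ⟨?_, h, f, rfl, ?_, by omega⟩, fun a => rfl, hψ⟩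
  · have e := eval₂_curvePoly_add (φ.act : Fq[X] →+* OreRing Fq L (AlgebraicClosure L))
      (tauL Fq L) h f
    have e' : tauL Fq L * tauL Fq L + φ.act h * tauL Fq L = φ.act f := by
      change _ + ψ.act (polyIncl h f h) * _ = ψ.act (polyIncl h f f)
      rw [← hψ, ← map_mul, ← map_mul, ← map_add, ← curveY_relation]
      congr 1
      ring
    exact add_eq_right.mp (e.trans e')
  · rw [hL, ← hf]
    exact degree_eq_natDegree (by rintro rfl; simp at hf; omega)

end Correspondence
end DrinfeldCorr

end

theorem mainTheorem2 {Fq : Type*} [Field Fq] [Fintype Fq]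
    (d m : ℕ) (hd : 5 ≤ d) (hodd : Odd d) (hm : 0 < m) (hmd : m ∣ d)
    (p : Fq[X]) (hp : p.Monic) (hpirr : Irreducible p) (hpdeg : p.natDegree = d / m)
    (α : Fq) (hα : α ≠ 0) (f : Fq[X]) (hf : f = C α * p ^ m)
    (h : Fq[X]) (hh : h ≠ 0) (hhdeg : h.natDegree ≤ (d - 1) / 2) (hph : ¬ p ∣ h)
    (hsmooth : DrinfeldCorr.IsSmoothAffine h f)
    {L : Type*} [Field L] [Algebra Fq L]
    [Algebra (DrinfeldCorr.CurveRing h f ⧸ DrinfeldCorr.primeIdeal h f p) L]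
    [IsScalarTower Fq (DrinfeldCorr.CurveRing h f ⧸ DrinfeldCorr.primeIdeal h f p) L]
    (hL : Module.finrank (DrinfeldCorr.CurveRing h f ⧸ DrinfeldCorr.primeIdeal h f p) L = m) :
    ∃ e : {c : DrinfeldCorr.IsoClass 2 (DrinfeldCorr.gammaX h f p L) //
            ∃ φ : DrinfeldCorr.Dr 2 (DrinfeldCorr.gammaX h f p L),
              DrinfeldCorr.isoClass φ = c ∧
              DrinfeldCorr.IsFrobeniusCharpoly φ (DrinfeldCorr.curvePoly h f)} ≃
          DrinfeldCorr.IsoClass 1 (DrinfeldCorr.gammaH h f p L),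
      ∀ (φ : DrinfeldCorr.Dr 2 (DrinfeldCorr.gammaX h f p L))
        (hφ : DrinfeldCorr.IsFrobeniusCharpoly φ (DrinfeldCorr.curvePoly h f)),
        ∃ ψ : DrinfeldCorr.Dr 1 (DrinfeldCorr.gammaH h f p L),
          ψ.act (DrinfeldCorr.polyIncl h f X) = φ.act X ∧
          ψ.act (AdjoinRoot.root (DrinfeldCorr.curvePoly h f)) = DrinfeldCorr.tauL Fq L ∧
          e ⟨DrinfeldCorr.isoClass φ, φ, rfl, hφ⟩ = DrinfeldCorr.isoClass ψ := by
  classical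
  have hd0 : 0 < d := by omega
  have hf0 : f.natDegree = d := by
    rw [hf, natDegree_C_mul hα, natDegree_pow, hpdeg, Nat.mul_div_cancel' hmd]
  have hdm : m * p.natDegree = d := by rw [hpdeg, Nat.mul_div_cancel' hmd]
  have hh2 : 2 * h.natDegree < d := by omega
  have hLd : Module.finrank Fq L = d := by
    rw [DrinfeldCorr.finrank_eq_of_residue (h := h) (f := f) hpirr, hL, mul_comm, hdm]
  let S := {c : DrinfeldCorr.IsoClass 2 (DrinfeldCorr.gammaX h f p L) //
    ∃ φ : DrinfeldCorr.Dr 2 (DrinfeldCorr.gammaX h f p L), DrinfeldCorr.isoClass φ = c ∧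
      DrinfeldCorr.IsFrobeniusCharpoly φ (DrinfeldCorr.curvePoly h f)}
  choose ext hext using DrinfeldCorr.exists_extends (p := p) hodd hf0 hh2 hLd
  let F : S → DrinfeldCorr.IsoClass 1 (DrinfeldCorr.gammaH h f p L) := fun c =>
    DrinfeldCorr.isoClass (ext c.2.choose c.2.choose_spec.2)
  have hF : ∀ φ hφ ψ, DrinfeldCorr.Extends φ ψ →
      F ⟨DrinfeldCorr.isoClass φ, φ, rfl, hφ⟩ = DrinfeldCorr.isoClass ψ := by
    intro φ hφ ψ hψ
    let c : S := ⟨DrinfeldCorr.isoClass φ, φ, rfl, hφ⟩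
    exact Quotient.sound ((DrinfeldCorr.Extends.isoClosure_iff hodd hh hLd c.2.choose_spec.2 hφ
      (hext _ _) hψ).mp (Quotient.exact c.2.choose_spec.1))
  have hbij : Function.Bijective F := by
    constructor
    · rintro ⟨_, φ, rfl, hφ⟩ ⟨_, φ', rfl, hφ'⟩ he
      rw [hF φ hφ _ (hext φ hφ), hF φ' hφ' _ (hext φ' hφ')] at he
      exact Subtype.ext (Quotient.sound ((DrinfeldCorr.Extends.isoClosure_iff hodd hh hLd hφ hφ'
        (hext φ hφ) (hext φ' hφ')).mpr (Quotient.exact he)))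
    · intro c
      obtain ⟨ψ, rfl⟩ := Quotient.exists_rep c
      obtain ⟨ψ', hψ', hY⟩ :=
        DrinfeldCorr.exists_twist hodd hf0 hh2 hLd hpirr hf hdm hph ψ
      obtain ⟨φ, hφ, hE⟩ := DrinfeldCorr.exists_restriction hodd hf0 hh2 hLd ψ' hY
      exact ⟨⟨DrinfeldCorr.isoClass φ, φ, rfl, hφ⟩,
        (hF φ hφ ψ' hE).trans (Quotient.sound hψ').symm⟩
  refine ⟨Equiv.ofBijective F hbij, fun φ hφ => ?_⟩
  exact ⟨ext φ hφ, (hext φ hφ).1 X, (hext φ hφ).2, hF φ hφ _ (hext φ hφ)⟩
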